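/- Let $X$ be a compact metric space and let $A\subset\mathbb R^m$ be compact and convex; $\mathcal P(\cdot)$ denotes Borel probability measures with the weak topology. Let $c:X\times A\times\mathcal P(X)\to\mathbb R$ be a cost function, $p(\cdot\mid x,a,\mu)\in\mathcal P(X)$ a transition probability, and $0<\beta<1$ a discount factor. Assume: (i) if $x_n\to x$ in $X$, $a_n\to a$ in $A$ and $\mu_n\to\mu$ weakly, then $c(x_n,a_n,\mu_n)\to c(x,a,\mu)$ and $p(\cdot\mid x_n,a_n,\mu_n)\to p(\cdot\mid x,a,\mu)$ weakly; (ii) there are constants $L,K\ge 0$ and $M$ with $|c(x,a,\mu)-c(\hat x,\hat a,\mu)|\le L\,(d_X(x,\hat x)+\|a-\hat a\|)$, $W_1(p(\cdot\mid x,a,\mu),p(\cdot\mid\hat x,\hat a,\mu))\le K\,(d_X(x,\hat x)+\|a-\hat a\|)$ and $|c(x,a,\mu)|\le M$ for all $x,\hat x\in X$, $a,\hat a\in A$, $\mu\in\mathcal P(X)$, where $W_1$ is the 1-Wasserstein distance. A policy is a stochastic kernel $\pi(da\mid x)$ from $X$ to $A$, and $(\pi\otimes\mu)(da,dx):=\pi(da\mid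 x)\,\mu(dx)$. For an initial law $\rho\in\mathcal P(X)$, a Markov policy $\boldsymbol\pi=(\pi_t)_{t\ge0}$ and a flow $\boldsymbol\mu=(\mu_t)_{t\ge0}$ in $\mathcal P(X)$, let $J_\rho(\boldsymbol\pi,\boldsymbol\mu)=E\big[\sum_{t\ge0}\beta^t c(x_t,a_t,\mu_t)\big]$, where $x_0\sim\rho$, $a_t\sim\pi_t(\cdot\mid x_t)$ and $x_{t+1}\sim p(\cdot\mid x_t,a_t,\mu_t)$. A non-stationary mean-field equilibrium (MFE) with initial measure $\mu_0$ is a pair $(\boldsymbol\pi,\boldsymbol\mu)$, where $\boldsymbol\mu$ starts at $\mu_0$, such that $J_{\mu_0}(\boldsymbol\pi,\boldsymbol\mu)\le J_{\mu_0}(\boldsymbol\pi',\boldsymbol\mu)$ for every Markov policy $\boldsymbol\pi'$ and $\mu_{t+1}(\cdot)=\int p(\cdot\mid x,a,\mu_t)\,\pi_t(da\mid x)\,\mu_t(dx)$ for all $t\ge0$. A stationary MFE is a pair $(\pi,\mu)$ of a policy and a measure $\mu\in\mathcal P(X)$ such that the constant policy $\pi$ minimizes $J_\mu(\cdot,\boldsymbol\mu)$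 over all Markov policies for the constant flow $\boldsymbol\mu=(\mu,\mu,\dots)$, and $\mu(\cdot)=\int p(\cdot\mid x,a,\mu)\,\pi(da\mid x)\,\mu(dx)$. A non-stationary MFE $(\hat\pi_t,\hat\mu_t)_t$ is asymptotically discount optimal if $\hat\pi_t\otimes\hat\mu_t\to\pi\otimes\mu$ weakly as $t\to\infty$ for some stationary MFE $(\pi,\mu)$. Theorem. Assume that each stationary state measure has a unique associated policy: if $(\pi,\mu)$ and $(\pi',\mu)$ are stationary MFE, then $\pi(\cdot\mid x)=\pi'(\cdot\mid x)$ for $\mu$-almost every $x$. Let $\mu_0\in\mathcal P(X)$ and let $(\hat\pi_t,\hat\mu_t)_{t\ge0}$ be a non-stationary MFE with initial measure $\mu_0$. Then $(\hat\pi_t,\hat\mu_t)_t$ is asymptotically discount optimal if and only if $(\hat\mu_t)_t$ converges weakly in $\mathcal P(X)$ as $t\to\infty$. -/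

import Mathlib

open MeasureTheory ProbabilityTheory Filter Topology
open scoped ENNReal NNReal

/-- Data `(X, A, c, p)` of a discounted mean-field game with discount factor `0 ≤ β < 1`.
`p μ (x, a)` is the law `p(· | x, a, μ)` of the next state. -/
structure MFG (X A : Type*) [MeasurableSpace X] [MeasurableSpace A] where
  c : X → A → ProbabilityMeasure X → ℝ
  p : ProbabilityMeasure X → Kernel (X × A) X
  p_markov : ∀ μ, IsMarkovKernel (p μ)
  β : ℝ
  β_nonneg : 0 ≤ β
  β_lt_one : β < 1

/-- A (randomized) decision rule: a stochastic kernel `π(da | x)` from states to actions. -/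
abbrev Policy (X A : Type*) [MeasurableSpace X] [MeasurableSpace A] : Type _ :=
  {π : Kernel X A // IsMarkovKernel π}

instance instIsMarkovKernelPolicy {X A : Type*} [MeasurableSpace X] [MeasurableSpace A]
    (π : Policy X A) : IsMarkovKernel π.1 := π.2

instance instIsMarkovKernelMFG {X A : Type*} [MeasurableSpace X] [MeasurableSpace A]
    (G : MFG X A) (μ : ProbabilityMeasure X) : IsMarkovKernel (G.p μ) := G.p_markov μ

/-- The joint law `π(da | x) μ(dx)` on `X × A`. -/
noncomputable def jointLaw {X A : Type*} [MeasurableSpace X] [MeasurableSpace A]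
    (π : Policy X A) (μ : ProbabilityMeasure X) : ProbabilityMeasure (X × A) :=
  ⟨(μ : Measure X) ⊗ₘ π.1, inferInstance⟩

/-- The 1-Wasserstein distance in its dual form, with values in `[0, ∞]`
(finite on a compact space). -/
noncomputable def wasserstein1 {X : Type*} [PseudoMetricSpace X] [MeasurableSpace X]
    (μ ν : ProbabilityMeasure X) : ℝ≥0∞ :=
  ⨆ (g : X → ℝ) (_ : LipschitzWith 1 g),
    ENNReal.ofReal |∫ x, g x ∂(μ : Measure X) - ∫ x, g x ∂(ν : Measure X)|

namespace MFG

section Dynamics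

variable {X A : Type*} [MeasurableSpace X] [MeasurableSpace A]

/-- `p(· | x, a, μ)` as a point of the space of probability measures. -/
noncomputable def next (G : MFG X A) (x : X) (a : A) (μ : ProbabilityMeasure X) :
    ProbabilityMeasure X :=
  ⟨G.p μ (x, a), inferInstance⟩

/-- One step of the state-action process under the policies `π` when the state-measure flow is
`μ`: from `(xₜ, aₜ)`, draw `xₜ₊₁ ∼ p(· | xₜ, aₜ, μₜ)` and then `aₜ₊₁ ∼ πₜ₊₁(· | xₜ₊₁)`. -/
noncomputable def stepKernel (G : MFG X A) (π : ℕ → Policy X A) (μ : ℕ → ProbabilityMeasure X)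
    (t : ℕ) : Kernel (X × A) (X × A) :=
  G.p (μ t) ⊗ₖ Kernel.prodMkLeft (X × A) (π (t + 1)).1

instance instIsMarkovKernelStepKernel (G : MFG X A) (π : ℕ → Policy X A)
    (μ : ℕ → ProbabilityMeasure X) (t : ℕ) : IsMarkovKernel (G.stepKernel π μ t) := by
  unfold stepKernel; infer_instance

/-- The step kernel as a kernel from histories, which depends only on the last entry. -/
noncomputable def historyKernel (G : MFG X A) (π : ℕ → Policy X A)
    (μ : ℕ → ProbabilityMeasure X) (t : ℕ) :
    Kernel (Finset.Iic t → X × A) (X × A) :=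
  (G.stepKernel π μ t).comap (fun h => h ⟨t, Finset.mem_Iic.2 le_rfl⟩) (measurable_pi_apply _)

instance instIsMarkovKernelHistoryKernel (G : MFG X A) (π : ℕ → Policy X A)
    (μ : ℕ → ProbabilityMeasure X) (t : ℕ) : IsMarkovKernel (G.historyKernel π μ t) := by
  unfold historyKernel; infer_instance

/-- The law, on the space of trajectories `(x₀, a₀), (x₁, a₁), …`, of the state-action process of
a single player using the Markov policy `π` in the environment `μ`, with `x₀ ∼ ρ`. -/
noncomputable def pathLaw (G : MFG X A) (ρ : ProbabilityMeasure X) (π : ℕ → Policy X A)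
    (μ : ℕ → ProbabilityMeasure X) : Measure (ℕ → X × A) :=
  Kernel.trajMeasure (X := fun _ => X × A) (jointLaw (π 0) ρ : Measure (X × A))
    (G.historyKernel π μ)

/-- The discounted cost `E^π [∑ₜ βᵗ c(xₜ, aₜ, μₜ)]` with `x₀ ∼ ρ`. -/
noncomputable def cost (G : MFG X A) (ρ : ProbabilityMeasure X) (π : ℕ → Policy X A)
    (μ : ℕ → ProbabilityMeasure X) : ℝ :=
  ∫ ω, ∑' t : ℕ, G.β ^ t * G.c (ω t).1 (ω t).2 (μ t) ∂(G.pathLaw ρ π μ)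

/-- `(πₜ, μₜ)ₜ` is a mean-field equilibrium of the infinite-horizon non-stationary game
`(X, A, c, p, μ₀)`. -/
structure IsNonstationaryMFE (G : MFG X A) (μ₀ : ProbabilityMeasure X) (π : ℕ → Policy X A)
    (μ : ℕ → ProbabilityMeasure X) : Prop where
  initial : μ 0 = μ₀
  evolution : ∀ t, (μ (t + 1) : Measure X) =
    (jointLaw (π t) (μ t) : Measure (X × A)).bind (G.p (μ t))
  optimal : ∀ π' : ℕ → Policy X A, G.cost μ₀ π μ ≤ G.cost μ₀ π' μ

/-- `(π, μ)` is a mean-field equilibrium of the stationary game `(X, A, c, p)`: the constant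
policy `π` is optimal among all Markov policies for the constant flow `μ` with `x₀ ∼ μ`, and `μ`
is invariant. -/
structure IsStationaryMFE (G : MFG X A) (π : Policy X A) (μ : ProbabilityMeasure X) : Prop where
  invariant : (μ : Measure X) = (jointLaw π μ : Measure (X × A)).bind (G.p μ)
  optimal : ∀ π' : ℕ → Policy X A,
    G.cost μ (fun _ => π) (fun _ => μ) ≤ G.cost μ π' (fun _ => μ)

/-- Each stationary state measure has a unique associated policy. Policies are identified when
they agree almost everywhere for the state measure. -/
def UniqueStationaryPolicy (G : MFG X A) : Prop :=
  ∀ (μ : ProbabilityMeasure X) (π π' : Policy X A),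
    G.IsStationaryMFE π μ → G.IsStationaryMFE π' μ → ∀ᵐ x ∂(μ : Measure X), π.1 x = π'.1 x

/-- Asymptotically discount optimal mean-field equilibria: non-stationary equilibria whose joint
laws converge weakly to the joint law of a stationary equilibrium. -/
def IsADOMFE [TopologicalSpace X] [TopologicalSpace A] [OpensMeasurableSpace (X × A)]
    (G : MFG X A) (μ₀ : ProbabilityMeasure X) (π : ℕ → Policy X A)
    (μ : ℕ → ProbabilityMeasure X) : Prop :=
  G.IsNonstationaryMFE μ₀ π μ ∧
    ∃ (πs : Policy X A) (μs : ProbabilityMeasure X), G.IsStationaryMFE πs μs ∧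
      Tendsto (fun t => jointLaw (π t) (μ t)) atTop (𝓝 (jointLaw πs μs))

end Dynamics

section Assumptions

variable {X A : Type*} [MetricSpace X] [MeasurableSpace X] [BorelSpace X]
  [MetricSpace A] [MeasurableSpace A]

/-- Continuous convergence of `c` and weakly continuous convergence of `p`, Lipschitz continuity
of both in the state-action pair uniformly in the state measure, and boundedness of `c`. -/
structure Regular (G : MFG X A) : Prop where
  cost_tendsto : ∀ (x : ℕ → X) (a : ℕ → A) (μ : ℕ → ProbabilityMeasure X)
    (x₀ : X) (a₀ : A) (μ₀ : ProbabilityMeasure X),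
    Tendsto x atTop (𝓝 x₀) → Tendsto a atTop (𝓝 a₀) → Tendsto μ atTop (𝓝 μ₀) →
      Tendsto (fun n => G.c (x n) (a n) (μ n)) atTop (𝓝 (G.c x₀ a₀ μ₀))
  next_tendsto : ∀ (x : ℕ → X) (a : ℕ → A) (μ : ℕ → ProbabilityMeasure X)
    (x₀ : X) (a₀ : A) (μ₀ : ProbabilityMeasure X),
    Tendsto x atTop (𝓝 x₀) → Tendsto a atTop (𝓝 a₀) → Tendsto μ atTop (𝓝 μ₀) →
      Tendsto (fun n => G.next (x n) (a n) (μ n)) atTop (𝓝 (G.next x₀ a₀ μ₀))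
  cost_lipschitz : ∃ L : ℝ≥0, ∀ (x x' : X) (a a' : A) (μ : ProbabilityMeasure X),
    |G.c x a μ - G.c x' a' μ| ≤ L * (dist x x' + dist a a')
  next_lipschitz : ∃ K : ℝ≥0, ∀ (x x' : X) (a a' : A) (μ : ProbabilityMeasure X),
    wasserstein1 (G.next x a μ) (G.next x' a' μ) ≤
      ENNReal.ofReal (K * (dist x x' + dist a a'))
  cost_bounded : ∃ M : ℝ, ∀ (x : X) (a : A) (μ : ProbabilityMeasure X), |G.c x a μ| ≤ M

end Assumptions

end MFG

/-! The state law is the first marginal of the joint law, so convergence of joint laws forces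
convergence of state laws. Conversely, let `μ t → ν`. The space of probability measures on `X × A`
is compact, so it suffices that the joint laws have a single cluster point. A cluster point has
first marginal `ν` and disintegrates as `πs ⊗ ν`; once `(πs, ν)` is known to be a stationary
equilibrium, uniqueness of the policy identifies all cluster points.

Invariance passes to the limit by continuity of `p`. Optimality is encoded in the Bellman gap `c + β
∫ J (t+1) dp - J t ≥ 0`, where `J` is the sequence of value functions along the flow: cost minus
initial value is the discounted sum of the expected gaps (`hasSum_bellmanGap`), so in equilibrium
every expected gap vanishes (`integral_bellmanGap`). By contraction, `J t` converges uniformly to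
the value function of the constant flow `ν` (`tendsto_value_sequence`). The gaps then converge
uniformly too, the limit gap integrates to zero under `πs ⊗ ν`, and `πs` is optimal. -/

namespace MFG

/-! ### One-time marginals of the trajectory law -/

section Marginals

variable {X A : Type*} [MeasurableSpace X] [MeasurableSpace A]

instance instIsProbabilityMeasurePathLaw (G : MFG X A) (ρ : ProbabilityMeasure X)
    (π : ℕ → Policy X A) (μ : ℕ → ProbabilityMeasure X) :
    IsProbabilityMeasure (G.pathLaw ρ π μ) := by
  unfold pathLaw; infer_instance

/-- The law of the state `xₜ` of a single player. -/
noncomputable def stateLaw (G : MFG X A) (ρ : ProbabilityMeasure X) (π : ℕ → Policy X A)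
    (μ : ℕ → ProbabilityMeasure X) : ℕ → ProbabilityMeasure X
  | 0 => ρ
  | t + 1 => ⟨(jointLaw (π t) (G.stateLaw ρ π μ t) : Measure (X × A)).bind (G.p (μ t)),
      inferInstance⟩

theorem bind_stepKernel (G : MFG X A) (π : ℕ → Policy X A) (μ : ℕ → ProbabilityMeasure X) (t : ℕ)
    (γ : Measure (X × A)) [IsProbabilityMeasure γ] :
    γ.bind (G.stepKernel π μ t) = (γ.bind (G.p (μ t))) ⊗ₘ (π (t + 1)).1 := by
  ext s hs
  rw [Measure.bind_apply hs (Kernel.aemeasurable _), Measure.compProd_apply hs,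
    Measure.lintegral_bind (Kernel.aemeasurable _)
      (Kernel.measurable_kernel_prodMk_left hs).aemeasurable]
  refine lintegral_congr fun z => ?_
  rw [stepKernel, Kernel.compProd_apply hs]
  rfl

theorem pathLaw_map_zero (G : MFG X A) (ρ : ProbabilityMeasure X) (π : ℕ → Policy X A)
    (μ : ℕ → ProbabilityMeasure X) :
    (G.pathLaw ρ π μ).map (fun ω => ω 0) = (jointLaw (π 0) ρ : Measure (X × A)) := by
  have h0 : (fun ω : ℕ → X × A => ω 0) =
      (fun y : Finset.Iic 0 → X × A => y ⟨0, Finset.mem_Iic.2 le_rfl⟩) ∘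
        Preorder.frestrictLe (π := fun _ => X × A) 0 := rfl
  have h1 : (G.pathLaw ρ π μ).map (Preorder.frestrictLe (π := fun _ => X × A) 0) =
      (jointLaw (π 0) ρ : Measure (X × A)).map
        (MeasurableEquiv.piUnique (fun _ : Finset.Iic 0 => X × A)).symm := by
    rw [pathLaw, Kernel.trajMeasure, Measure.map_comp _ _ (by fun_prop),
      Kernel.traj_map_frestrictLe_of_le le_rfl, Measure.deterministic_comp_eq_map]
    exact Measure.map_id
  have hm : Measurable fun y : Finset.Iic 0 → X × A => y ⟨0, Finset.mem_Iic.2 le_rfl⟩ :=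
    measurable_pi_apply _
  rw [h0, ← Measure.map_map hm (Preorder.measurable_frestrictLe 0), h1,
    Measure.map_map hm (MeasurableEquiv.measurable _)]
  exact Measure.map_id

theorem pathLaw_map_succ (G : MFG X A) (ρ : ProbabilityMeasure X) (π : ℕ → Policy X A)
    (μ : ℕ → ProbabilityMeasure X) (t : ℕ) :
    (G.pathLaw ρ π μ).map (fun ω => ω (t + 1)) =
      ((G.pathLaw ρ π μ).map (fun ω => ω t)).bind (G.stepKernel π μ t) := by
  have h := Kernel.map_frestrictLe_trajMeasure_compProd_eq_map_trajMeasure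
    (X := fun _ => X × A) (μ₀ := (jointLaw (π 0) ρ : Measure (X × A)))
    (κ := G.historyKernel π μ) (a := t)
  have h2 := congrArg Measure.snd h
  rw [Measure.snd_compProd, Measure.snd_map_prodMk (by fun_prop)] at h2
  rw [pathLaw, ← h2]
  have h3 : (fun ω : ℕ → X × A => ω t) =
      (fun y : Finset.Iic t → X × A => y ⟨t, Finset.mem_Iic.2 le_rfl⟩) ∘
        Preorder.frestrictLe (π := fun _ => X × A) t := rfl
  have hm : Measurable fun y : Finset.Iic t → X × A => y ⟨t, Finset.mem_Iic.2 le_rfl⟩ :=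
    measurable_pi_apply _
  rw [h3, ← Measure.map_map hm (Preorder.measurable_frestrictLe t)]
  ext s hs
  rw [Measure.bind_apply hs (Kernel.aemeasurable _), Measure.bind_apply hs (Kernel.aemeasurable _),
    lintegral_map (Kernel.measurable_coe _ hs) hm]
  rfl

/-- The cost involves each time separately, so these marginals replace the trajectory measure from
here on. -/
theorem pathLaw_map_eval (G : MFG X A) (ρ : ProbabilityMeasure X) (π : ℕ → Policy X A)
    (μ : ℕ → ProbabilityMeasure X) (t : ℕ) :
    (G.pathLaw ρ π μ).map (fun ω => ω t) =
      (jointLaw (π t) (G.stateLaw ρ π μ t) : Measure (X × A)) := by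
  induction t with
  | zero => exact G.pathLaw_map_zero ρ π μ
  | succ t ih =>
    rw [pathLaw_map_succ, ih, bind_stepKernel]
    rfl

/-- The discounted cost in terms of the laws of the state-action pairs `(xₜ, aₜ)`. -/
theorem hasSum_cost (G : MFG X A) (ρ : ProbabilityMeasure X) (π : ℕ → Policy X A)
    (μ : ℕ → ProbabilityMeasure X)
    (hmeas : ∀ t, Measurable fun z : X × A => G.c z.1 z.2 (μ t)) {M : ℝ}
    (hM : ∀ x a ν, |G.c x a ν| ≤ M) :
    HasSum (fun t => G.β ^ t * ∫ z, G.c z.1 z.2 (μ t)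
      ∂(jointLaw (π t) (G.stateLaw ρ π μ t) : Measure (X × A))) (G.cost ρ π μ) := by
  have hb : ∀ t (ω : ℕ → X × A), ‖G.β ^ t * G.c (ω t).1 (ω t).2 (μ t)‖ ≤ G.β ^ t * M := by
    intro t ω
    rw [norm_mul, norm_pow, Real.norm_of_nonneg G.β_nonneg]
    exact mul_le_mul_of_nonneg_left (hM _ _ _) (pow_nonneg G.β_nonneg t)
  have hint : ∀ t, Integrable (fun ω : ℕ → X × A => G.β ^ t * G.c (ω t).1 (ω t).2 (μ t))
      (G.pathLaw ρ π μ) := fun t =>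
    Integrable.of_bound
      (((hmeas t).comp (measurable_pi_apply t)).const_mul _).aestronglyMeasurable
      (G.β ^ t * M) (Eventually.of_forall (hb t))
  have key := hasSum_integral_of_summable_integral_norm hint (by
    refine Summable.of_nonneg_of_le (fun t => integral_nonneg fun ω => norm_nonneg _) (fun t => ?_)
      ((summable_geometric_of_lt_one G.β_nonneg G.β_lt_one).mul_right M)
    calc ∫ ω, ‖G.β ^ t * G.c (ω t).1 (ω t).2 (μ t)‖ ∂(G.pathLaw ρ π μ)
        ≤ ∫ _, G.β ^ t * M ∂(G.pathLaw ρ π μ) :=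
          integral_mono (hint t).norm (integrable_const _) (hb t)
      _ = G.β ^ t * M := by simp)
  have heq : ∀ t, G.β ^ t * ∫ z, G.c z.1 z.2 (μ t)
      ∂(jointLaw (π t) (G.stateLaw ρ π μ t) : Measure (X × A)) =
      ∫ ω, G.β ^ t * G.c (ω t).1 (ω t).2 (μ t) ∂(G.pathLaw ρ π μ) := fun t => by
    rw [integral_const_mul, ← G.pathLaw_map_eval ρ π μ t,
      integral_map (measurable_pi_apply t).aemeasurable (hmeas t).aestronglyMeasurable]
  simp_rw [heq]
  exact key

/-- Consistency of the equilibrium: a player using `π` reproduces the flow, since both obey the same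
recursion. -/
theorem IsNonstationaryMFE.stateLaw_eq {G : MFG X A} {μ₀ : ProbabilityMeasure X}
    {π : ℕ → Policy X A} {μ : ℕ → ProbabilityMeasure X} (h : G.IsNonstationaryMFE μ₀ π μ) (t : ℕ) :
    G.stateLaw μ₀ π μ t = μ t := by
  induction t with
  | zero => exact h.initial.symm
  | succ t ih =>
    refine Subtype.ext ?_
    change (jointLaw (π t) (G.stateLaw μ₀ π μ t) : Measure (X × A)).bind (G.p (μ t)) = _
    rw [ih]
    exact (h.evolution t).symm

theorem stateLaw_const {G : MFG X A} {π : Policy X A} {ν : ProbabilityMeasure X}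
    (h : (ν : Measure X) = (jointLaw π ν : Measure (X × A)).bind (G.p ν)) (t : ℕ) :
    G.stateLaw ν (fun _ => π) (fun _ => ν) t = ν := by
  induction t with
  | zero => rfl
  | succ t ih =>
    refine Subtype.ext ?_
    change (jointLaw π (G.stateLaw ν (fun _ => π) (fun _ => ν) t) : Measure (X × A)).bind
      (G.p ν) = _
    rw [ih]
    exact h.symm

theorem integral_jointLaw_fst (π : Policy X A) (ν : ProbabilityMeasure X) {f : X → ℝ}
    (hf : Measurable f) :
    ∫ z, f z.1 ∂(jointLaw π ν : Measure (X × A)) = ∫ x, f x ∂(ν : Measure X) := by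
  have h : (jointLaw π ν : Measure (X × A)).map Prod.fst = ν := by
    change ((ν : Measure X) ⊗ₘ π.1).fst = ν
    rw [Measure.fst_compProd]
  rw [← h, integral_map measurable_fst.aemeasurable (by rw [h]; exact hf.aestronglyMeasurable)]

/-- Disintegration; it turns a limit of joint laws back into a policy. -/
theorem exists_jointLaw_eq [StandardBorelSpace A] [Nonempty A] (γ : ProbabilityMeasure (X × A)) :
    ∃ π : Policy X A, jointLaw π (γ.map measurable_fst.aemeasurable) = γ :=
  ⟨⟨(γ : Measure (X × A)).condKernel, inferInstance⟩,
    Subtype.ext ((γ : Measure (X × A)).disintegrate _)⟩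

end Marginals

end MFG

/-! ### Analytic tools: weak convergence, fibrewise minimization, a backward recursion -/

/-- Integration is jointly continuous in a continuous function on a compact space and a
probability measure. -/
theorem tendsto_integral_of_tendsto {Y ι : Type*} [TopologicalSpace Y] [CompactSpace Y]
    [MeasurableSpace Y] [OpensMeasurableSpace Y] {l : Filter ι} {f : ι → C(Y, ℝ)} {g : C(Y, ℝ)}
    {γ : ι → ProbabilityMeasure Y} {γ₀ : ProbabilityMeasure Y}
    (hf : Tendsto f l (𝓝 g)) (hγ : Tendsto γ l (𝓝 γ₀)) :
    Tendsto (fun i => ∫ y, f i y ∂(γ i : Measure Y)) l (𝓝 (∫ y, g y ∂(γ₀ : Measure Y))) := by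
  have hint : ∀ (h : C(Y, ℝ)) (ν : ProbabilityMeasure Y), Integrable h (ν : Measure Y) := fun h ν =>
    (BoundedContinuousFunction.mkOfCompact h).integrable _
  have h1 : Tendsto (fun i => ∫ y, g y ∂(γ i : Measure Y)) l (𝓝 (∫ y, g y ∂(γ₀ : Measure Y))) :=
    (ProbabilityMeasure.tendsto_iff_forall_integral_tendsto.1 hγ)
      (BoundedContinuousFunction.mkOfCompact g)
  have h2 : Tendsto (fun i => ∫ y, f i y ∂(γ i : Measure Y) - ∫ y, g y ∂(γ i : Measure Y)) l
      (𝓝 0) := by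
    refine squeeze_zero_norm (fun i => ?_) (tendsto_iff_norm_sub_tendsto_zero.1 hf)
    rw [← integral_sub (hint _ _) (hint _ _)]
    refine (norm_integral_le_of_norm_le_const (C := ‖f i - g‖)
      (Eventually.of_forall fun y => ?_)).trans (by simp)
    exact (f i - g).norm_coe_le_norm y
  simpa using h2.add h1

section FiberInf

variable {X A : Type*} [TopologicalSpace X] [TopologicalSpace A] [CompactSpace A]

/-- Partial minimization `x ↦ min_a f(x, a)`. -/
noncomputable def fiberInf (f : C(X × A, ℝ)) : C(X, ℝ) where
  toFun x := ⨅ a, f (x, a)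
  continuous_toFun := by
    have h := (isCompact_univ (X := A)).continuous_sInf (f := fun x a => f (x, a))
      (by exact f.continuous)
    simpa [sInf_range] using h

theorem bddBelow_fiber (f : C(X × A, ℝ)) (x : X) : BddBelow (Set.range fun a => f (x, a)) :=
  (isCompact_range (f.continuous.comp (Continuous.prodMk_right x))).bddBelow

theorem fiberInf_le (f : C(X × A, ℝ)) (x : X) (a : A) : fiberInf f x ≤ f (x, a) :=
  ciInf_le (bddBelow_fiber f x) a

/-- Minimization is nonexpansive in the uniform norm; hence the Bellman operator contracts. -/
theorem norm_fiberInf_sub_le [CompactSpace X] [Nonempty A] (f g : C(X × A, ℝ)) :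
    ‖fiberInf f - fiberInf g‖ ≤ ‖f - g‖ := by
  have key : ∀ (f g : C(X × A, ℝ)) x, fiberInf f x - fiberInf g x ≤ ‖f - g‖ := by
    intro f g x
    rw [sub_le_iff_le_add, ← sub_le_iff_le_add']
    refine le_ciInf fun a => ?_
    have h1 := fiberInf_le f x a
    have h2 := (le_abs_self _).trans ((f - g).norm_coe_le_norm (x, a))
    rw [ContinuousMap.sub_apply] at h2
    linarith
  refine (ContinuousMap.norm_le _ (norm_nonneg _)).2 fun x => abs_le.2 ⟨?_, key f g x⟩
  have h := key g f x
  rw [norm_sub_rev] at h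
  rw [ContinuousMap.sub_apply]
  linarith

theorem continuous_fiberInf [CompactSpace X] [Nonempty A] : Continuous (fiberInf : C(X × A, ℝ) → C(X, ℝ)) :=
  (LipschitzWith.of_dist_le_mul (K := 1) fun f g => by
    simpa [dist_eq_norm] using norm_fiberInf_sub_le f g).continuous

/-- A measurable `ε`-minimizer of `a ↦ f(x, a)`. -/
theorem exists_measurable_selector [Nonempty A] [TopologicalSpace.SeparableSpace A]
    [MeasurableSpace X] [OpensMeasurableSpace X] [MeasurableSpace A] (f : C(X × A, ℝ)) {ε : ℝ}
    (hε : 0 < ε) :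
    ∃ s : X → A, Measurable s ∧ ∀ x, f (x, s x) ≤ fiberInf f x + ε := by
  classical
  have hex : ∀ x, ∃ n, f (x, TopologicalSpace.denseSeq A n) < fiberInf f x + ε := by
    intro x
    obtain ⟨a, ha⟩ := exists_lt_of_ciInf_lt
      (show ⨅ a, f (x, a) < fiberInf f x + ε from lt_add_of_pos_right _ hε)
    have hopen : IsOpen {a | f (x, a) < fiberInf f x + ε} :=
      isOpen_lt (f.continuous.comp (Continuous.prodMk_right x)) continuous_const
    obtain ⟨n, hn⟩ := (TopologicalSpace.denseRange_denseSeq A).exists_mem_open hopen ⟨a, ha⟩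
    exact ⟨n, hn⟩
  -- The first `ε`-good index in a dense sequence is measurable in `x`, as each index is good on an
  -- open set.
  refine ⟨fun x => TopologicalSpace.denseSeq A (Nat.find (hex x)), ?_,
    fun x => (Nat.find_spec (hex x)).le⟩
  refine (measurable_from_nat (f := TopologicalSpace.denseSeq A)).comp
    (measurable_find hex fun n => ?_)
  exact (isOpen_lt (f.continuous.comp (Continuous.prodMk_left _))
    ((fiberInf f).continuous.add continuous_const)).measurableSet

end FiberInf

/-- A bounded sequence with `eₜ ≤ β eₜ₊₁ + dₜ`, where `β < 1` and `dₜ → 0`, tends to zero. -/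
theorem tendsto_zero_of_le_mul_succ_add {β B : ℝ} (hβ : 0 ≤ β) (hβ' : β < 1) {e d : ℕ → ℝ}
    (he : ∀ t, 0 ≤ e t) (hB : ∀ t, e t ≤ B) (h : ∀ t, e t ≤ β * e (t + 1) + d t)
    (hd : Tendsto d atTop (𝓝 0)) : Tendsto e atTop (𝓝 0) := by
  have h1 : 0 < 1 - β := sub_pos.2 hβ'
  rw [Metric.tendsto_atTop]
  intro ε hε
  -- With this threshold `ε / 2` is preserved by the recursion: `β * (ε / 2) + (1 - β) * (ε / 2) = ε
  -- / 2`.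
  obtain ⟨N, hN⟩ := eventually_atTop.1 (hd.eventually_lt_const (u := (1 - β) * (ε / 2))
    (by positivity))
  refine ⟨N, fun t ht => ?_⟩
  have key : ∀ n, ∀ t ≥ N, e t ≤ β ^ n * B + ε / 2 := by
    intro n
    induction n with
    | zero => intro t _; have := hB t; simp only [pow_zero, one_mul]; linarith
    | succ n ih =>
      intro t ht
      have h2 := mul_le_mul_of_nonneg_left (ih (t + 1) (by omega)) hβ
      have h3 := h t
      have h4 := hN t ht
      rw [pow_succ]
      nlinarith
  have hlim : Tendsto (fun n => β ^ n * B + ε / 2) atTop (𝓝 (0 * B + ε / 2)) :=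
    ((tendsto_pow_atTop_nhds_zero_of_lt_one hβ hβ').mul_const B).add_const _
  have := ge_of_tendsto' hlim fun n => key n t ht
  rw [Real.dist_eq, sub_zero, abs_of_nonneg (he t)]
  linarith

/-! ### Bellman operators and value functions -/

namespace MFG

section Bellman

variable {X A : Type*} [MetricSpace X] [CompactSpace X] [MeasurableSpace X] [BorelSpace X]
  [MetricSpace A] [MeasurableSpace A] {G : MFG X A}

/-- Sequences suffice because the weak topology on probability measures over a compact metric space
is metrizable. -/
theorem Regular.continuous_cost (hG : G.Regular) :
    Continuous fun q : ProbabilityMeasure X × X × A => G.c q.2.1 q.2.2 q.1 := by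
  refine continuous_iff_seqContinuous.2 fun q q₀ hq => ?_
  exact hG.cost_tendsto _ _ _ _ _ _ (hq.snd_nhds.fst_nhds) hq.snd_nhds.snd_nhds hq.fst_nhds

theorem Regular.continuous_next (hG : G.Regular) :
    Continuous fun q : ProbabilityMeasure X × X × A => G.next q.2.1 q.2.2 q.1 := by
  refine continuous_iff_seqContinuous.2 fun q q₀ hq => ?_
  exact hG.next_tendsto _ _ _ _ _ _ (hq.snd_nhds.fst_nhds) hq.snd_nhds.snd_nhds hq.fst_nhds

/-- The stage cost as a continuous map from state measures to continuous functions of the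
state-action pair. -/
noncomputable def costMap (hG : G.Regular) : C(ProbabilityMeasure X, C(X × A, ℝ)) :=
  ContinuousMap.curry ⟨_, hG.continuous_cost⟩

/-- The expectation of `u` at the next state, as a continuous map from state measures to
continuous functions of the state-action pair. -/
noncomputable def nextMap (hG : G.Regular) (u : C(X, ℝ)) : C(ProbabilityMeasure X, C(X × A, ℝ)) :=
  ContinuousMap.curry ⟨fun q => ∫ y, u y ∂(G.next q.2.1 q.2.2 q.1 : Measure X),
    (ProbabilityMeasure.continuous_integral_boundedContinuousFunction
      (BoundedContinuousFunction.mkOfCompact u)).comp hG.continuous_next⟩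

theorem nextMap_apply (hG : G.Regular) (u : C(X, ℝ)) (ν : ProbabilityMeasure X) (z : X × A) :
    nextMap hG u ν z = ∫ y, u y ∂(G.p ν z) := rfl

theorem integrable_continuousMap {Y : Type*} [TopologicalSpace Y] [CompactSpace Y]
    [MeasurableSpace Y] [OpensMeasurableSpace Y] (h : C(Y, ℝ)) (ν : Measure Y)
    [IsFiniteMeasure ν] : Integrable h ν :=
  (BoundedContinuousFunction.mkOfCompact h).integrable _

/-- Duality that moves the evolution of the measure onto the test function. -/
theorem integral_nextMap (hG : G.Regular) (u : C(X, ℝ)) (ν : ProbabilityMeasure X)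
    (γ : Measure (X × A)) [IsProbabilityMeasure γ] :
    ∫ z, nextMap hG u ν z ∂γ = ∫ y, u y ∂(γ.bind (G.p ν)) := by
  have h : γ.bind (G.p ν) = (G.p ν ∘ₖ Kernel.const Unit γ) () := by
    rw [Kernel.comp_apply, Kernel.const_apply]
  rw [h, Kernel.integral_comp (integrable_continuousMap u _)]
  rfl

variable [CompactSpace A]

/-- The state-action value `c(x, a, ν) + β ∫ u(y) p(dy | x, a, ν)`. -/
noncomputable def actionValue (hG : G.Regular) (u : C(X, ℝ)) (ν : ProbabilityMeasure X) :
    C(X × A, ℝ) :=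
  costMap hG ν + G.β • nextMap hG u ν

/-- The Bellman operator. -/
noncomputable def bellman (hG : G.Regular) (u : C(X, ℝ)) (ν : ProbabilityMeasure X) : C(X, ℝ) :=
  fiberInf (actionValue hG u ν)

theorem norm_nextMap_sub_le (hG : G.Regular) (u v : C(X, ℝ)) (ν : ProbabilityMeasure X) :
    ‖nextMap hG u ν - nextMap hG v ν‖ ≤ ‖u - v‖ := by
  refine (ContinuousMap.norm_le _ (norm_nonneg _)).2 fun z => ?_
  rw [ContinuousMap.sub_apply, nextMap_apply, nextMap_apply,
    ← integral_sub (integrable_continuousMap u _) (integrable_continuousMap v _)]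
  exact (norm_integral_le_of_norm_le_const (C := ‖u - v‖)
    (Eventually.of_forall fun y => (u - v).norm_coe_le_norm y)).trans (by simp)

theorem norm_actionValue_sub_le (hG : G.Regular) (u v : C(X, ℝ)) (ν : ProbabilityMeasure X) :
    ‖actionValue hG u ν - actionValue hG v ν‖ ≤ G.β * ‖u - v‖ := by
  rw [actionValue, actionValue, add_sub_add_left_eq_sub, ← smul_sub, norm_smul,
    Real.norm_of_nonneg G.β_nonneg]
  exact mul_le_mul_of_nonneg_left (norm_nextMap_sub_le hG u v ν) G.β_nonneg

/-- Currying turns joint continuity into continuity in the state measure that is uniform over the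
compact `X × A`. -/
theorem continuous_actionValue (hG : G.Regular) (u : C(X, ℝ)) :
    Continuous (actionValue hG u) :=
  (costMap hG).continuous.add ((nextMap hG u).continuous.const_smul G.β)

/-- The excess of the state-action value for the continuation value `u` over the value `v`. -/
noncomputable def bellmanGap (hG : G.Regular) (u v : C(X, ℝ)) (ν : ProbabilityMeasure X) :
    C(X × A, ℝ) :=
  actionValue hG u ν - v.comp ContinuousMap.fst

theorem bellmanGap_nonneg (hG : G.Regular) (u : C(X, ℝ)) (ν : ProbabilityMeasure X) (z : X × A) :
    0 ≤ bellmanGap hG u (bellman hG u ν) ν z :=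
  sub_nonneg.2 (fiberInf_le (actionValue hG u ν) z.1 z.2)

variable [Nonempty A]

theorem norm_bellman_sub_le (hG : G.Regular) (u v : C(X, ℝ)) (ν : ProbabilityMeasure X) :
    ‖bellman hG u ν - bellman hG v ν‖ ≤ G.β * ‖u - v‖ :=
  (norm_fiberInf_sub_le _ _).trans (norm_actionValue_sub_le hG u v ν)

theorem continuous_bellman (hG : G.Regular) (u : C(X, ℝ)) : Continuous (bellman hG u) :=
  continuous_fiberInf.comp (continuous_actionValue hG u)

/-- The space of state measures is compact. -/
theorem exists_norm_bellman_zero_le (hG : G.Regular) :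
    ∃ M : ℝ, ∀ ν, ‖bellman hG 0 ν‖ ≤ M := by
  obtain ⟨B, hB⟩ := (isCompact_range (continuous_bellman hG 0)).isBounded.exists_norm_le
  exact ⟨B, fun ν => hB _ ⟨ν, rfl⟩⟩

/-- The value functions along a flow of state measures. -/
theorem exists_value_sequence (hG : G.Regular) (μ : ℕ → ProbabilityMeasure X) :
    ∃ J : ℕ → C(X, ℝ), (∃ B, ∀ t, ‖J t‖ ≤ B) ∧ ∀ t, J t = bellman hG (J (t + 1)) (μ t) := by
  obtain ⟨M, hM⟩ := exists_norm_bellman_zero_le hG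
  have hbound : ∀ (J : BoundedContinuousFunction ℕ C(X, ℝ)) t,
      ‖bellman hG (J (t + 1)) (μ t)‖ ≤ G.β * ‖J‖ + M := by
    intro J t
    have h1 := norm_bellman_sub_le hG (J (t + 1)) 0 (μ t)
    rw [sub_zero] at h1
    calc ‖bellman hG (J (t + 1)) (μ t)‖
        ≤ ‖bellman hG (J (t + 1)) (μ t) - bellman hG 0 (μ t)‖ + ‖bellman hG 0 (μ t)‖ := by
          simpa using norm_add_le (bellman hG (J (t + 1)) (μ t) - bellman hG 0 (μ t))
            (bellman hG 0 (μ t))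
      _ ≤ G.β * ‖J‖ + M := add_le_add (h1.trans
          (mul_le_mul_of_nonneg_left (J.norm_coe_le_norm _) G.β_nonneg)) (hM _)
  -- With no terminal time to recurse from, all the `J t` are found at once, as the fixed point of a
  -- contraction on bounded sequences.
  let S : BoundedContinuousFunction ℕ C(X, ℝ) → BoundedContinuousFunction ℕ C(X, ℝ) := fun J =>
    BoundedContinuousFunction.ofNormedAddCommGroupDiscrete
      (fun t => bellman hG (J (t + 1)) (μ t)) _ (hbound J)
  have hS : ContractingWith ⟨G.β, G.β_nonneg⟩ S := by
    refine ⟨by exact_mod_cast G.β_lt_one, LipschitzWith.of_dist_le_mul fun J J' => ?_⟩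
    refine (BoundedContinuousFunction.dist_le
      (mul_nonneg G.β_nonneg dist_nonneg)).2 fun t => ?_
    rw [dist_eq_norm]
    refine (norm_bellman_sub_le hG _ _ _).trans (mul_le_mul_of_nonneg_left ?_ G.β_nonneg)
    rw [← dist_eq_norm]
    exact BoundedContinuousFunction.dist_coe_le_dist _
  let J : BoundedContinuousFunction ℕ C(X, ℝ) := ContractingWith.fixedPoint S hS
  have hJ : S J = J := hS.fixedPoint_isFixedPt
  exact ⟨J, ⟨_, J.norm_coe_le_norm⟩, fun t => (DFunLike.congr_fun hJ t).symm⟩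

theorem exists_value_function (hG : G.Regular) (ν : ProbabilityMeasure X) :
    ∃ J : C(X, ℝ), J = bellman hG J ν := by
  have hS : ContractingWith ⟨G.β, G.β_nonneg⟩ fun u => bellman hG u ν := by
    refine ⟨by exact_mod_cast G.β_lt_one, LipschitzWith.of_dist_le_mul fun u v => ?_⟩
    rw [dist_eq_norm, dist_eq_norm]
    exact norm_bellman_sub_le hG u v ν
  exact ⟨_, (hS.fixedPoint_isFixedPt).symm⟩

/-- The error at time `t` is at most `β` times the error at `t + 1` plus the effect of replacing `ν`
by `μ t`, which tends to zero. -/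
theorem tendsto_value_sequence (hG : G.Regular) {μ : ℕ → ProbabilityMeasure X}
    {ν : ProbabilityMeasure X} (hμ : Tendsto μ atTop (𝓝 ν)) {J : ℕ → C(X, ℝ)} {B : ℝ}
    (hB : ∀ t, ‖J t‖ ≤ B) (hJ : ∀ t, J t = bellman hG (J (t + 1)) (μ t)) {u : C(X, ℝ)}
    (hu : u = bellman hG u ν) : Tendsto J atTop (𝓝 u) := by
  rw [tendsto_iff_norm_sub_tendsto_zero]
  refine tendsto_zero_of_le_mul_succ_add (B := B + ‖u‖)
    (d := fun t => ‖bellman hG u (μ t) - bellman hG u ν‖) G.β_nonneg G.β_lt_one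
    (fun t => norm_nonneg _) (fun t => ?_) (fun t => ?_) ?_
  · exact (norm_sub_le _ _).trans (add_le_add_left (hB t) _)
  · calc ‖J t - u‖ = ‖(bellman hG (J (t + 1)) (μ t) - bellman hG u (μ t)) +
          (bellman hG u (μ t) - bellman hG u ν)‖ := by
          rw [sub_add_sub_cancel, ← hJ, ← hu]
      _ ≤ _ := (norm_add_le _ _).trans (add_le_add_left (norm_bellman_sub_le hG _ _ _) _)
  · exact tendsto_iff_norm_sub_tendsto_zero.1 (((continuous_bellman hG u).tendsto ν).comp hμ)

end Bellman

/-! ### Optimality through Bellman gaps, and passage to the limit -/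

section Verification

variable {X A : Type*} [MetricSpace X] [CompactSpace X] [MeasurableSpace X] [BorelSpace X]
  [MetricSpace A] [CompactSpace A] [MeasurableSpace A] [BorelSpace A] {G : MFG X A}

/-- The discounted Bellman gaps along the play sum to the difference between the cost and the
initial value. -/
theorem hasSum_bellmanGap (hG : G.Regular) (ρ : ProbabilityMeasure X) (π : ℕ → Policy X A)
    (μ : ℕ → ProbabilityMeasure X) {J : ℕ → C(X, ℝ)} {B : ℝ} (hB : ∀ t, ‖J t‖ ≤ B) :
    HasSum (fun t => G.β ^ t * ∫ z, bellmanGap hG (J (t + 1)) (J t) (μ t) z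
      ∂(jointLaw (π t) (G.stateLaw ρ π μ t) : Measure (X × A)))
      (G.cost ρ π μ - ∫ x, J 0 x ∂(ρ : Measure X)) := by
  obtain ⟨M, hM⟩ := hG.cost_bounded
  have hc := G.hasSum_cost ρ π μ (fun t => (costMap hG (μ t)).continuous.measurable) hM
  have ha : Summable fun t => G.β ^ t * ∫ x, J t x ∂(G.stateLaw ρ π μ t : Measure X) := by
    refine Summable.of_norm_bounded
      ((summable_geometric_of_lt_one G.β_nonneg G.β_lt_one).mul_right B) fun t => ?_
    rw [norm_mul, norm_pow, Real.norm_of_nonneg G.β_nonneg]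
    refine mul_le_mul_of_nonneg_left ?_ (pow_nonneg G.β_nonneg t)
    exact (norm_integral_le_of_norm_le_const (C := B)
      (Eventually.of_forall fun y => ((J t).norm_coe_le_norm y).trans (hB t))).trans (by simp)
  -- Telescoping: the series of discounted expected values, shifted by one, minus itself leaves `-∫
  -- J 0 dρ`.
  have ha' := ((hasSum_nat_add_iff' 1).2 ha.hasSum).sub ha.hasSum
  have hsum := hc.add ha'
  have h0 : G.stateLaw ρ π μ 0 = ρ := rfl
  rw [Finset.sum_range_one, pow_zero, one_mul, h0, sub_sub_cancel_left, ← sub_eq_add_neg] at hsum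
  convert hsum using 1
  funext t
  set γ : Measure (X × A) := (jointLaw (π t) (G.stateLaw ρ π μ t) : Measure (X × A))
  have h1 : ∫ z, J t z.1 ∂γ = ∫ x, J t x ∂(G.stateLaw ρ π μ t : Measure X) :=
    integral_jointLaw_fst _ _ (J t).continuous.measurable
  have h2 : ∫ z, nextMap hG (J (t + 1)) (μ t) z ∂γ =
      ∫ x, J (t + 1) x ∂(G.stateLaw ρ π μ (t + 1) : Measure X) :=
    integral_nextMap hG _ _ _
  have h3 : ∫ z, bellmanGap hG (J (t + 1)) (J t) (μ t) z ∂γ =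
      ∫ z, G.c z.1 z.2 (μ t) ∂γ + G.β * ∫ z, nextMap hG (J (t + 1)) (μ t) z ∂γ -
        ∫ z, J t z.1 ∂γ := by
    have hcost := integrable_continuousMap (costMap hG (μ t)) γ
    have hnext := (integrable_continuousMap (nextMap hG (J (t + 1)) (μ t)) γ).const_mul G.β
    have hsumm : Integrable (fun z => costMap hG (μ t) z +
        G.β * nextMap hG (J (t + 1)) (μ t) z) γ := hcost.add hnext
    have hval := integrable_continuousMap ((J t).comp (ContinuousMap.fst : C(X × A, X))) γ
    calc ∫ z, bellmanGap hG (J (t + 1)) (J t) (μ t) z ∂γ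
        = ∫ z, (costMap hG (μ t) z + G.β * nextMap hG (J (t + 1)) (μ t) z -
            (J t).comp ContinuousMap.fst z) ∂γ := rfl
      _ = _ := by
        rw [integral_sub hsumm hval, integral_add hcost hnext, integral_const_mul]
        rfl
  rw [h3, h1, h2, pow_succ]
  ring

theorem integral_value_le_cost (hG : G.Regular) (ρ : ProbabilityMeasure X) (π : ℕ → Policy X A)
    (μ : ℕ → ProbabilityMeasure X) {J : ℕ → C(X, ℝ)} {B : ℝ} (hB : ∀ t, ‖J t‖ ≤ B)
    (hJ : ∀ t, J t = bellman hG (J (t + 1)) (μ t)) :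
    ∫ x, J 0 x ∂(ρ : Measure X) ≤ G.cost ρ π μ := by
  refine sub_nonneg.1 ((hasSum_bellmanGap hG ρ π μ hB).nonneg fun t =>
    mul_nonneg (pow_nonneg G.β_nonneg t) (integral_nonneg fun z => ?_))
  rw [hJ t]
  exact bellmanGap_nonneg hG _ _ z

/-- Under `ε`-minimizing selectors every gap is at most `ε`, and the discounted sum is at most a
geometric series. -/
theorem exists_cost_le [Nonempty A] (hG : G.Regular) (ρ : ProbabilityMeasure X)
    (μ : ℕ → ProbabilityMeasure X) {J : ℕ → C(X, ℝ)} {B : ℝ} (hB : ∀ t, ‖J t‖ ≤ B)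
    (hJ : ∀ t, J t = bellman hG (J (t + 1)) (μ t)) {ε : ℝ} (hε : 0 < ε) :
    ∃ π : ℕ → Policy X A, G.cost ρ π μ ≤ ∫ x, J 0 x ∂(ρ : Measure X) + (1 - G.β)⁻¹ * ε := by
  choose s hs hsε using fun t => exists_measurable_selector (actionValue hG (J (t + 1)) (μ t)) hε
  refine ⟨fun t => ⟨Kernel.deterministic (s t) (hs t), inferInstance⟩, ?_⟩
  rw [← sub_le_iff_le_add']
  refine hasSum_le (fun t => mul_le_mul_of_nonneg_left ?_ (pow_nonneg G.β_nonneg t))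
    (hasSum_bellmanGap hG ρ _ μ hB)
    ((hasSum_geometric_of_lt_one G.β_nonneg G.β_lt_one).mul_right ε)
  simp only [jointLaw, ProbabilityMeasure.coe_mk]
  rw [Measure.integral_compProd (integrable_continuousMap _ _)]
  refine (integral_mono_of_nonneg (g := fun _ => ε)
    (Eventually.of_forall fun x => integral_nonneg fun a => ?_) (integrable_const _)
    (Eventually.of_forall fun x => ?_)).trans (by simp)
  · rw [hJ t]
    exact bellmanGap_nonneg hG _ _ (x, a)
  · simp only [Kernel.deterministic_apply]
    rw [integral_dirac' (fun a => bellmanGap hG (J (t + 1)) (J t) (μ t) (x, a)) _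
      (((bellmanGap hG _ _ _).continuous.comp (Continuous.prodMk_right x)).stronglyMeasurable)]
    rw [hJ t]
    exact sub_le_iff_le_add'.2 (hsε t x)

/-- In equilibrium the cost equals the value, so a series of nonnegative terms sums to zero.
Positivity of `β` is needed to cancel `β ^ t` at times `t > 0`. -/
theorem IsNonstationaryMFE.integral_bellmanGap [Nonempty A] (hG : G.Regular) (hβ : 0 < G.β)
    {μ₀ : ProbabilityMeasure X} {π : ℕ → Policy X A} {μ : ℕ → ProbabilityMeasure X}
    (h : G.IsNonstationaryMFE μ₀ π μ) {J : ℕ → C(X, ℝ)} {B : ℝ} (hB : ∀ t, ‖J t‖ ≤ B)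
    (hJ : ∀ t, J t = bellman hG (J (t + 1)) (μ t)) (t : ℕ) :
    ∫ z, bellmanGap hG (J (t + 1)) (J t) (μ t) z ∂(jointLaw (π t) (μ t) : Measure (X × A)) = 0 := by
  have hle : G.cost μ₀ π μ ≤ ∫ x, J 0 x ∂(μ₀ : Measure X) := by
    have hlim : Tendsto (fun ε : ℝ => ∫ x, J 0 x ∂(μ₀ : Measure X) + (1 - G.β)⁻¹ * ε) (𝓝[>] 0)
        (𝓝 (∫ x, J 0 x ∂(μ₀ : Measure X) + (1 - G.β)⁻¹ * 0)) :=
      ((continuous_const.add (continuous_const.mul continuous_id)).tendsto 0).mono_left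
        nhdsWithin_le_nhds
    rw [mul_zero, add_zero] at hlim
    refine ge_of_tendsto hlim (eventually_mem_nhdsWithin.mono fun ε hε => ?_)
    obtain ⟨π', hπ'⟩ := exists_cost_le hG μ₀ μ hB hJ hε
    exact (h.optimal π').trans hπ'
  have hsum := hasSum_bellmanGap hG μ₀ π μ hB
  rw [le_antisymm hle (integral_value_le_cost hG μ₀ π μ hB hJ), sub_self,
    hasSum_zero_iff_of_nonneg] at hsum
  · have ht := congrFun hsum t
    rw [h.stateLaw_eq] at ht
    exact (mul_eq_zero.1 ht).resolve_left (pow_pos hβ t).ne'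
  · refine fun t => mul_nonneg (pow_nonneg G.β_nonneg t) (integral_nonneg fun z => ?_)
    rw [hJ t]
    exact bellmanGap_nonneg hG _ _ z

/-- A limit along a filter of the joint laws of an equilibrium whose state measures converge is the
joint law of a stationary equilibrium. -/
theorem IsNonstationaryMFE.isStationaryMFE_of_tendsto [Nonempty A] (hG : G.Regular) (hβ : 0 < G.β)
    {μ₀ : ProbabilityMeasure X} {π : ℕ → Policy X A} {μ : ℕ → ProbabilityMeasure X}
    (h : G.IsNonstationaryMFE μ₀ π μ) {ν : ProbabilityMeasure X} (hμ : Tendsto μ atTop (𝓝 ν))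
    {l : Filter ℕ} [l.NeBot] (hl : l ≤ atTop) {πs : Policy X A}
    (hlim : Tendsto (fun t => jointLaw (π t) (μ t)) l (𝓝 (jointLaw πs ν))) :
    G.IsStationaryMFE πs ν := by
  have hinv : (ν : Measure X) = (jointLaw πs ν : Measure (X × A)).bind (G.p ν) := by
    refine ext_of_forall_integral_eq_of_IsFiniteMeasure fun f => ?_
    have h1 : Tendsto (fun t => ∫ x, f x ∂(μ (t + 1) : Measure X)) l
        (𝓝 (∫ x, f x ∂(ν : Measure X))) :=
      (ProbabilityMeasure.tendsto_iff_forall_integral_tendsto.1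
        (hμ.comp (tendsto_add_atTop_nat 1)) f).mono_left hl
    have h2 := tendsto_integral_of_tendsto
      (((nextMap hG f.toContinuousMap).continuous.tendsto ν).comp (hμ.mono_left hl)) hlim
    rw [integral_nextMap] at h2
    refine tendsto_nhds_unique h1 (h2.congr fun t => ?_)
    rw [h.evolution t]
    exact integral_nextMap hG f.toContinuousMap (μ t) _
  obtain ⟨J, ⟨B, hB⟩, hJ⟩ := exists_value_sequence hG μ
  obtain ⟨u, hu⟩ := exists_value_function hG ν
  have hJu := tendsto_value_sequence hG hμ hB hJ hu
  -- Uniform convergence is needed here, since the measures integrating the gaps vary with `t` as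
  -- well.
  have hgap : Tendsto (fun t => bellmanGap hG (J (t + 1)) (J t) (μ t)) atTop
      (𝓝 (bellmanGap hG u u ν)) := by
    have h1 : Tendsto (fun t => actionValue hG (J (t + 1)) (μ t) - actionValue hG u (μ t)) atTop
        (𝓝 0) := by
      refine squeeze_zero_norm (fun t => norm_actionValue_sub_le hG _ _ _) ?_
      simpa using ((tendsto_iff_norm_sub_tendsto_zero.1 hJu).comp
        (tendsto_add_atTop_nat 1)).const_mul G.β
    have h2 := h1.add (((continuous_actionValue hG u).tendsto ν).comp hμ)
    have h3 : Tendsto (fun t => (J t).comp (ContinuousMap.fst : C(X × A, X))) atTop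
        (𝓝 (u.comp ContinuousMap.fst)) :=
      ((ContinuousMap.continuous_precomp _).tendsto u).comp hJu
    simpa [bellmanGap] using h2.sub h3
  have hzero : ∫ z, bellmanGap hG u u ν z ∂(jointLaw πs ν : Measure (X × A)) = 0 := by
    refine tendsto_nhds_unique (tendsto_integral_of_tendsto (hgap.mono_left hl) hlim) ?_
    simp only [h.integral_bellmanGap hG hβ hB hJ, tendsto_const_nhds]
  -- The constant sequence `u` serves as values for the constant flow: `∫ u dν` bounds every cost
  -- from below, and the zero gap shows that `πs` attains it.
  refine ⟨hinv, fun π' => le_trans (le_of_eq ?_)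
    (integral_value_le_cost hG ν π' (fun _ => ν) (J := fun _ => u) (fun _ => le_rfl) fun _ => hu)⟩
  have hsum := hasSum_bellmanGap hG ν (fun _ => πs) (fun _ => ν) (J := fun _ => u)
    (fun _ => le_rfl)
  simp only [stateLaw_const hinv, hzero, mul_zero] at hsum
  exact sub_eq_zero.1 (hsum.unique hasSum_zero)

theorem tendsto_of_tendsto_jointLaw {ι : Type*} {l : Filter ι} {π : ι → Policy X A}
    {μ : ι → ProbabilityMeasure X} {γ : ProbabilityMeasure (X × A)}
    (h : Tendsto (fun t => jointLaw (π t) (μ t)) l (𝓝 γ)) :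
    Tendsto μ l (𝓝 (γ.map measurable_fst.aemeasurable)) := by
  refine (((ProbabilityMeasure.continuous_map continuous_fst).tendsto γ).comp h).congr fun t => ?_
  refine Subtype.ext ?_
  change ((μ t : Measure X) ⊗ₘ (π t).1).fst = _
  rw [Measure.fst_compProd]
  rfl

theorem isADOMFE_iff_exists_tendsto [StandardBorelSpace A] [Nonempty A] (hG : G.Regular)
    (hβ : 0 < G.β) (hunique : G.UniqueStationaryPolicy) {μ₀ : ProbabilityMeasure X}
    {π : ℕ → Policy X A} {μ : ℕ → ProbabilityMeasure X} (h : G.IsNonstationaryMFE μ₀ π μ) :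
    G.IsADOMFE μ₀ π μ ↔ ∃ ν : ProbabilityMeasure X, Tendsto μ atTop (𝓝 ν) := by
  refine ⟨fun ⟨_, _, _, _, hlim⟩ => ⟨_, tendsto_of_tendsto_jointLaw hlim⟩, ?_⟩
  rintro ⟨ν, hμ⟩
  have hcluster : ∀ γ : ProbabilityMeasure (X × A),
      MapClusterPt γ atTop (fun t => jointLaw (π t) (μ t)) →
      ∃ πs : Policy X A, G.IsStationaryMFE πs ν ∧ jointLaw πs ν = γ := by
    intro γ hγ
    obtain ⟨U, hU, hlim⟩ := mapClusterPt_iff_ultrafilter.1 hγ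
    obtain ⟨πs, hπs⟩ := exists_jointLaw_eq γ
    -- Uniqueness of weak limits identifies the first marginal of `γ` with `ν`.
    rw [tendsto_nhds_unique (tendsto_of_tendsto_jointLaw hlim) (hμ.mono_left hU)] at hπs
    rw [← hπs] at hlim
    exact ⟨πs, h.isStationaryMFE_of_tendsto hG hβ hμ hU hlim, hπs⟩
  obtain ⟨γ, hγ⟩ := exists_clusterPt_of_compactSpace
    (map (fun t => jointLaw (π t) (μ t)) atTop)
  obtain ⟨πs, hπs, hπsγ⟩ := hcluster γ hγ
  refine ⟨h, πs, ν, hπs, tendsto_nhds_of_unique_mapClusterPt fun γ' hγ' => ?_⟩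
  obtain ⟨πs', hπs', rfl⟩ := hcluster γ' hγ'
  -- Almost everywhere equality of the kernels suffices, as the joint law ignores `ν`-null sets of
  -- states.
  exact Subtype.ext (Measure.compProd_congr (hunique ν πs' πs hπs' hπs))

end Verification

end MFG

theorem mainTheorem2 {X : Type*} [MetricSpace X] [CompactSpace X] [MeasurableSpace X]
    [BorelSpace X] {m : ℕ} (A : Set (EuclideanSpace ℝ (Fin m))) (hA_compact : IsCompact A)
    (hA_convex : Convex ℝ A) (G : MFG X A) (hβ : 0 < G.β) (hG : G.Regular)
    (hunique : G.UniqueStationaryPolicy) (μ₀ : ProbabilityMeasure X) (π : ℕ → Policy X A)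
    (μ : ℕ → ProbabilityMeasure X) (hMFE : G.IsNonstationaryMFE μ₀ π μ) :
    G.IsADOMFE μ₀ π μ ↔ ∃ ν : ProbabilityMeasure X, Tendsto μ atTop (𝓝 ν) := by
  have : CompactSpace A := isCompact_iff_compactSpace.1 hA_compact
  have : StandardBorelSpace A := hA_compact.isClosed.measurableSet.standardBorel
  -- A policy exists, so some probability measure lives on `X × A`.
  have : Nonempty A :=
    (nonempty_of_isProbabilityMeasure (jointLaw (π 0) μ₀ : Measure (X × A))).map Prod.snd
  exact MFG.isADOMFE_iff_exists_tendsto hG hβ hunique hMFE
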